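/- \textbf{Conventions.} Formulas are first-order formulas with equality, with variables $v_0,v_1,\dots$, connectives $\neg,\to$ and quantifiers $\forall,\exists$, in a countable language of arithmetic with infinitely many function and relation symbols of each arity. $\Gamma\vdash\varphi$ means derivability in a Hilbert calculus. Gödel numbers are taken with respect to an elementary bijection between $\mathbb N$ and the set of formulas; $\overline n$ is the dyadic numeral of $n$, $\ulcorner\varphi\urcorner$ the numeral of the code of $\varphi$. $\mathsf{EA}$ is $\mathsf I\Delta_0+\mathsf{exp}$, extended by function and relation symbols for pairing, list entries, numerals, substitution, and the relations ``$v$ is free in $y$'' and ``$t$ is free for $v$ in $y$'', with their recursive defining axioms (bounded formulas with these symbols being allowed in induction). On codes, $\dot\neg y$, $\dot\forall v.\,y$, $\dot\exists v.\,y$ denote the codes of the negation and the quantifications of $y$, and $\mathtt s(y,v,x)$ the code of the result of substituting the numeral of $x$ for the variable $v$ in the formula $y$. Let $S$ and $T$ be consistent theories with $\mathsf{EA}\subseteq S\subseteq T$ (inclusion as deductive theories). Let $\alpha$ be a formula with no free variable other than $v_0$ that numerates $T$ in $S$, i.e. $S\vdash\alpha(\ulcorner\varphi\urcorner)$ if and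 only if $\varphi$ is an axiom of $T$. Let $\mathtt{Pr}_T(x)$ be the standard provability predicate $\exists p\,\mathtt{Prf}_\alpha(x,p)$: $p$ is a list of formulas containing $x$ as its last line, each of which is a logical axiom, satisfies $\alpha$, or follows from earlier lines by modus ponens or generalization. For an array of quantifiers $\vec Q=Q_0\cdots Q_{n-1}$ with $Q_i\in\{\forall,\exists\}$ let $\overline{\forall}=\exists$, $\overline{\exists}=\forall$, and let $\omega\text{-}\mathrm{Con}^{\vec Q}_T$ be the sentence of arithmetic that says: for every formula $y$ with exactly $n$ free variables $w_0,\dots,w_{n-1}$ (listed in any order), $$\bigl(Q_0x_0\cdots Q_{n-1}x_{n-1}\ \mathtt{Pr}_T(\mathtt s(y,\vec w,\vec x))\bigr)\ \to\ \neg\,\mathtt{Pr}_T\bigl(\dot{\overline{Q_0}}w_0.\cdots\dot{\overline{Q_{n-1}}}w_{n-1}.\,\dot\neg y\bigr),$$ where $\mathtt s(y,\vec w,\vec x)$ is the result of substituting the numerals of $x_0,\dots,x_{n-1}$ for $w_0,\dots,w_{n-1}$ in $y$. Let $\mathtt{Tr}(S)_T$ be the theory in the language of $S$ extended by a new unary predicate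 $\mathtt{Tr}$ whose axioms are those of $S$ (whose induction schema is not extended to $\mathtt{Tr}$) and, for all $x,y$ and all variables $v$, \begin{itemize} \item[A1] $\mathtt{Pr}_T(x)\to\mathtt{Tr}(x)$; \item[A2] $\mathtt{Tr}(\dot\forall v.\,y)\leftrightarrow\forall x\,\mathtt{Tr}(\mathtt s(y,v,x))$; \item[A3] $\mathtt{Tr}(\dot\exists v.\,y)\leftrightarrow\exists x\,\mathtt{Tr}(\mathtt s(y,v,x))$; \item[A4] $\mathtt{Tr}(\dot\neg y)\leftrightarrow\neg\mathtt{Tr}(y)$; \item[A5] $\mathtt{Tr}(x)\to\mathtt{Formula}(x)$, where $\mathtt{Formula}(x)$ says that $x$ is the code of a formula. \end{itemize} \textbf{Theorem.} For every array of quantifiers $\vec Q$, $\ \mathtt{Tr}(S)_T\vdash\omega\text{-}\mathrm{Con}^{\vec Q}_T$. -/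

import Mathlib

open FirstOrder

namespace OmegaCon

/-! ### First-order logic with named variables

Terms are the terms of Mathlib over the variables `v₀, v₁, …`. Formulas carry the name of the
variable that a quantifier binds, as in the usual arithmetization of syntax. -/

/-- Formulas of a first-order language with equality, over the variables `v₀, v₁, …`. -/
inductive Fml (L : FirstOrder.Language.{0, 0}) : Type
  | equal (s t : L.Term ℕ) : Fml L
  | rel {n : ℕ} (R : L.Relations n) (ts : Fin n → L.Term ℕ) : Fml L
  | neg (φ : Fml L) : Fml L
  | imp (φ ψ : Fml L) : Fml L
  | all (v : ℕ) (φ : Fml L) : Fml L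
  | ex (v : ℕ) (φ : Fml L) : Fml L

namespace Fml

variable {L : FirstOrder.Language.{0, 0}}

/-- The free variables of a formula. -/
def fv : Fml L → Finset ℕ
  | equal s t => s.varFinset ∪ t.varFinset
  | rel _ ts => Finset.univ.biUnion fun i => (ts i).varFinset
  | neg φ => φ.fv
  | imp φ ψ => φ.fv ∪ ψ.fv
  | all v φ => φ.fv.erase v
  | ex v φ => φ.fv.erase v

/-- `t[s/v]` for terms. -/
def subTm (t : L.Term ℕ) (v : ℕ) (s : L.Term ℕ) : L.Term ℕ :=
  t.subst (Function.update FirstOrder.Language.Term.var v s)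

/-- `φ[s/v]`: every free occurrence of `v` is replaced by `s`. -/
def sub : Fml L → ℕ → L.Term ℕ → Fml L
  | equal a b, v, s => equal (subTm a v s) (subTm b v s)
  | rel R ts, v, s => rel R fun i => subTm (ts i) v s
  | neg φ, v, s => neg (φ.sub v s)
  | imp φ ψ, v, s => imp (φ.sub v s) (ψ.sub v s)
  | all u φ, v, s => if u = v then all u φ else all u (φ.sub v s)
  | ex u φ, v, s => if u = v then ex u φ else ex u (φ.sub v s)

/-- The term `s` is free for the variable `v` in a formula: `φ[s/v]` captures no variable. -/
def FreeFor (s : L.Term ℕ) (v : ℕ) : Fml L → Prop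
  | equal _ _ => True
  | rel _ _ => True
  | neg φ => FreeFor s v φ
  | imp φ ψ => FreeFor s v φ ∧ FreeFor s v ψ
  | all u φ => v ∈ (all u φ).fv → u ∉ s.varFinset ∧ FreeFor s v φ
  | ex u φ => v ∈ (ex u φ).fv → u ∉ s.varFinset ∧ FreeFor s v φ

/-- Conjunction. -/
def and (φ ψ : Fml L) : Fml L := neg (imp φ (neg ψ))

/-- Disjunction. -/
def or (φ ψ : Fml L) : Fml L := imp (neg φ) ψ

/-- Equivalence. -/
def iff (φ ψ : Fml L) : Fml L := and (imp φ ψ) (imp ψ φ)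

/-- A formula of `L` read in an extension of `L`. -/
def lift {L' : FirstOrder.Language.{0, 0}} (g : L →ᴸ L') : Fml L → Fml L'
  | equal s t => equal (g.onTerm s) (g.onTerm t)
  | rel R ts => rel (g.onRelation R) fun i => g.onTerm (ts i)
  | neg φ => neg (φ.lift g)
  | imp φ ψ => imp (φ.lift g) (ψ.lift g)
  | all v φ => all v (φ.lift g)
  | ex v φ => ex v (φ.lift g)

end Fml

/-- The logical axioms of a Hilbert calculus for first-order logic with equality. -/
inductive LogicalAxiom {L : FirstOrder.Language.{0, 0}} : Fml L → Prop
  | weaken (φ ψ : Fml L) : LogicalAxiom (.imp φ (.imp ψ φ))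
  | distrib (φ ψ χ : Fml L) :
      LogicalAxiom (.imp (.imp φ (.imp ψ χ)) (.imp (.imp φ ψ) (.imp φ χ)))
  | contra (φ ψ : Fml L) : LogicalAxiom (.imp (.imp (.neg φ) (.neg ψ)) (.imp ψ φ))
  | allInst (φ : Fml L) (v : ℕ) (t : L.Term ℕ) (h : φ.FreeFor t v) :
      LogicalAxiom (.imp (.all v φ) (φ.sub v t))
  | allImp (φ ψ : Fml L) (v : ℕ) (h : v ∉ φ.fv) :
      LogicalAxiom (.imp (.all v (.imp φ ψ)) (.imp φ (.all v ψ)))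
  | exInst (φ : Fml L) (v : ℕ) (t : L.Term ℕ) (h : φ.FreeFor t v) :
      LogicalAxiom (.imp (φ.sub v t) (.ex v φ))
  | exImp (φ ψ : Fml L) (v : ℕ) (h : v ∉ ψ.fv) :
      LogicalAxiom (.imp (.all v (.imp φ ψ)) (.imp (.ex v φ) ψ))
  | eqRefl (t : L.Term ℕ) : LogicalAxiom (.equal t t)
  | eqSubst (φ : Fml L) (v : ℕ) (t : L.Term ℕ) (h : φ.FreeFor t v) :
      LogicalAxiom (.imp (.equal (.var v) t) (.imp φ (φ.sub v t)))

/-- `Γ ⊢ φ`: derivability from the axioms `Γ` by modus ponens and generalization. Free variables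
of axioms are read universally. -/
inductive Provable {L : FirstOrder.Language.{0, 0}} (Γ : Set (Fml L)) : Fml L → Prop
  | ax {φ : Fml L} (h : φ ∈ Γ) : Provable Γ φ
  | logical {φ : Fml L} (h : LogicalAxiom φ) : Provable Γ φ
  | mp {φ ψ : Fml L} (h₁ : Provable Γ (.imp φ ψ)) (h₂ : Provable Γ φ) : Provable Γ ψ
  | gen {φ : Fml L} (v : ℕ) (h : Provable Γ φ) : Provable Γ (.all v φ)

/-- The theory `Γ` is consistent. -/
def Consistent {L : FirstOrder.Language.{0, 0}} (Γ : Set (Fml L)) : Prop :=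
  ¬ ∃ φ : Fml L, Provable Γ φ ∧ Provable Γ (.neg φ)

/-- The theory `Γ` includes the theory `Δ`. -/
def Includes {L : FirstOrder.Language.{0, 0}} (Γ Δ : Set (Fml L)) : Prop :=
  ∀ φ ∈ Δ, Provable Γ φ

/-! ### The language of arithmetic

A countable language with symbols `f^k_0, f^k_1, …` and `R^k_0, R^k_1, …` of every arity `k`.
Finitely many of them are given a name and axioms below; the others are at the disposal of
the theories that extend elementary arithmetic. -/

/-- The language of the theories under consideration. -/
def arith : FirstOrder.Language.{0, 0} := ⟨fun _ => ℕ, fun _ => ℕ⟩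

/-- Terms of arithmetic. -/
abbrev Tm : Type := arith.Term ℕ

/-- The variable `vᵢ`. -/
def va (i : ℕ) : Tm := FirstOrder.Language.Term.var i

/-- The constant symbol `f^0_i`. -/
def fn0 (i : ℕ) : Tm := FirstOrder.Language.Term.func (L := arith) (l := 0) i ![]

/-- The unary function symbol `f^1_i`. -/
def fn1 (i : ℕ) (t : Tm) : Tm := FirstOrder.Language.Term.func (L := arith) (l := 1) i ![t]

/-- The binary function symbol `f^2_i`. -/
def fn2 (i : ℕ) (s t : Tm) : Tm := FirstOrder.Language.Term.func (L := arith) (l := 2) i ![s, t]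

/-- The ternary function symbol `f^3_i`. -/
def fn3 (i : ℕ) (r s t : Tm) : Tm := FirstOrder.Language.Term.func (L := arith) (l := 3) i ![r, s, t]

/-- The binary relation symbol `R^2_i`. -/
def rl2 (i : ℕ) (s t : Tm) : Fml arith := Fml.rel (L := arith) (n := 2) i ![s, t]

/-- The ternary relation symbol `R^3_i`. -/
def rl3 (i : ℕ) (r s t : Tm) : Fml arith := Fml.rel (L := arith) (n := 3) i ![r, s, t]

/-- `0` -/
def zero : Tm := fn0 0
/-- successor -/
def suc (t : Tm) : Tm := fn1 0 t
/-- `2 ^ t` -/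
def expo (t : Tm) : Tm := fn1 1 t
/-- the code of the numeral of `t` -/
def numD (t : Tm) : Tm := fn1 2 t
/-- `s + t` -/
def add (s t : Tm) : Tm := fn2 0 s t
/-- `s * t` -/
def mul (s t : Tm) : Tm := fn2 1 s t
/-- the pair of `s` and `t` -/
def pair (s t : Tm) : Tm := fn2 2 s t
/-- the list `s` without its first `t` entries -/
def drop (s t : Tm) : Tm := fn2 3 s t
/-- substitution in a term: in (the term coded by) `r`, (the term coded by) `t` for the variable
of index `s` -/
def subT (r s t : Tm) : Tm := fn3 0 r s t
/-- the same for a list of terms `r` -/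
def subL (r s t : Tm) : Tm := fn3 1 r s t
/-- the same for a formula `r` -/
def subF (r s t : Tm) : Tm := fn3 2 r s t
/-- `s ≤ t` -/
def le (s t : Tm) : Fml arith := rl2 0 s t
/-- the variable of index `s` occurs in the term `t` -/
def freeT (s t : Tm) : Fml arith := rl2 1 s t
/-- the variable of index `s` occurs in the list of terms `t` -/
def freeL (s t : Tm) : Fml arith := rl2 2 s t
/-- the variable of index `s` is free in the formula `t` -/
def freeF (s t : Tm) : Fml arith := rl2 3 s t
/-- the term `r` is free for the variable of index `s` in the formula `t` -/
def freeFor (r s t : Tm) : Fml arith := rl3 0 r s t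

/-- Equality of terms of arithmetic. -/
def eq (s t : Tm) : Fml arith := Fml.equal s t

/-- The term `SS0`. -/
def two : Tm := suc (suc zero)

/-- The efficient (dyadic) numeral of a natural number. -/
def numeral : ℕ → Tm
  | 0 => zero
  | n + 1 =>
    if (n + 1) % 2 = 0 then mul two (numeral ((n + 1) / 2))
    else suc (mul two (numeral ((n + 1) / 2)))
decreasing_by all_goals omega

/-! ### Gödel numbering -/

/-- The code of a list of numbers. -/
def listCode : List ℕ → ℕ
  | [] => 0
  | a :: l => Nat.pair a (listCode l) + 1

/-- The code of a term. -/
def termCode : Tm → ℕ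
  | .var i => 2 * i
  | .func f ts =>
    2 * Nat.pair (show ℕ from f) (listCode (List.ofFn fun i => termCode (ts i))) + 1

/-- The code of a formula. -/
def code : Fml arith → ℕ
  | .equal s t => 6 * Nat.pair (termCode s) (termCode t)
  | .rel R ts =>
    6 * Nat.pair (show ℕ from R) (listCode (List.ofFn fun i => termCode (ts i))) + 1
  | .neg φ => 6 * code φ + 2
  | .imp φ ψ => 6 * Nat.pair (code φ) (code ψ) + 3
  | .all v φ => 6 * Nat.pair v (code φ) + 4
  | .ex v φ => 6 * Nat.pair v (code φ) + 5

theorem listCode_injective : Function.Injective listCode := by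
  intro l
  induction l with
  | nil => intro m h; cases m with
    | nil => rfl
    | cons b m => simp [listCode] at h
  | cons a l ih => intro m h; cases m with
    | nil => simp [listCode] at h
    | cons b m =>
      simp only [listCode, Nat.add_right_cancel_iff, Nat.pair_eq_pair] at h
      rw [h.1, ih h.2]

theorem args_injective {m n : ℕ} {ts : Fin m → Tm} {us : Fin n → Tm}
    (ih : ∀ i u, termCode (ts i) = termCode u → ts i = u)
    (h : listCode (List.ofFn fun i => termCode (ts i)) =
      listCode (List.ofFn fun i => termCode (us i))) :
    ∃ e : m = n, ts = fun i => us (Fin.cast e i) := by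
  have h1 := listCode_injective h
  have e : m = n := by simpa using congrArg List.length h1
  subst e
  refine ⟨rfl, funext fun i => ih i _ ?_⟩
  exact congrFun (List.ofFn_injective h1) i

theorem termCode_injective : Function.Injective termCode := by
  intro t
  induction t with
  | var i => intro u h; cases u with
    | var j => simp only [termCode] at h; congr 1; omega
    | func g us => simp only [termCode] at h; omega
  | func f ts ih => intro u h; cases u with
    | var j => simp only [termCode] at h; omega
    | func g us =>
      simp only [termCode] at h
      have h2 := Nat.pair_eq_pair.1 (show Nat.pair _ _ = Nat.pair _ _ by
        exact Nat.eq_of_mul_eq_mul_left two_pos (Nat.add_right_cancel h))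
      obtain ⟨e, h3⟩ := args_injective (fun i u => @ih i u) h2.2
      subst e
      have h4 : f = g := h2.1
      rw [h4, h3]; rfl

theorem code_injective : Function.Injective code := by
  intro φ
  induction φ with
  | equal s t =>
    intro ψ h
    cases ψ <;> simp only [code] at h <;> try omega
    have h2 := Nat.pair_eq_pair.1 (Nat.eq_of_mul_eq_mul_left (by norm_num) h)
    rw [termCode_injective h2.1, termCode_injective h2.2]
  | rel R ts =>
    intro ψ h
    cases ψ <;> simp only [code] at h <;> try omega
    have h2 := Nat.pair_eq_pair.1 (Nat.eq_of_mul_eq_mul_left (by norm_num)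
      (Nat.add_right_cancel h))
    obtain ⟨e, h3⟩ := args_injective (fun i u h => termCode_injective h) h2.2
    subst e
    have h4 : R = _ := h2.1
    rw [h4, h3]; rfl
  | neg φ ih =>
    intro ψ h
    cases ψ <;> simp only [code] at h <;> try omega
    rw [ih (Nat.eq_of_mul_eq_mul_left (by norm_num) (Nat.add_right_cancel h))]
  | imp φ χ ih1 ih2 =>
    intro ψ h
    cases ψ <;> simp only [code] at h <;> try omega
    have h2 := Nat.pair_eq_pair.1 (Nat.eq_of_mul_eq_mul_left (by norm_num)
      (Nat.add_right_cancel h))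
    rw [ih1 h2.1, ih2 h2.2]
  | all v φ ih =>
    intro ψ h
    cases ψ <;> simp only [code] at h <;> try omega
    have h2 := Nat.pair_eq_pair.1 (Nat.eq_of_mul_eq_mul_left (by norm_num)
      (Nat.add_right_cancel h))
    rw [h2.1, ih h2.2]
  | ex v φ ih =>
    intro ψ h
    cases ψ <;> simp only [code] at h <;> try omega
    have h2 := Nat.pair_eq_pair.1 (Nat.eq_of_mul_eq_mul_left (by norm_num)
      (Nat.add_right_cancel h))
    rw [h2.1, ih h2.2]

theorem termCode_surjective_aux (n : ℕ) :
    (∃ t, termCode t = n) ∧ ∃ ts : List Tm, listCode (ts.map termCode) = n := by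
  induction n using Nat.strong_induction_on with
  | _ n ih =>
    constructor
    · obtain ⟨m, rfl | rfl⟩ := Nat.even_or_odd' n
      · exact ⟨.var m, rfl⟩
      · have hm := Nat.unpair_right_le m
        obtain ⟨ts, hts⟩ := (ih (Nat.unpair m).2 (by omega)).2
        refine ⟨FirstOrder.Language.Term.func (L := arith) (l := ts.length) (Nat.unpair m).1 ts.get, ?_⟩
        have h1 : (List.ofFn fun i => termCode (ts.get i)) = ts.map termCode := by
          rw [← Function.comp_def termCode, ← List.map_ofFn, List.ofFn_get]
        simp only [termCode, h1, hts]
        simp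
    · cases n with
      | zero => exact ⟨[], rfl⟩
      | succ m =>
        have h1 := Nat.unpair_left_le m
        have h2 := Nat.unpair_right_le m
        obtain ⟨t, ht⟩ := (ih (Nat.unpair m).1 (by omega)).1
        obtain ⟨ts, hts⟩ := (ih (Nat.unpair m).2 (by omega)).2
        exact ⟨t :: ts, by simp [listCode, ht, hts]⟩

theorem termCode_surjective : Function.Surjective termCode := fun n =>
  (termCode_surjective_aux n).1

theorem code_surjective : Function.Surjective code := by
  intro n
  induction n using Nat.strong_induction_on with
  | _ n ih =>
    obtain ⟨m, r, hr, rfl⟩ : ∃ m r, r < 6 ∧ n = 6 * m + r :=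
      ⟨n / 6, n % 6, Nat.mod_lt _ (by norm_num), (Nat.div_add_mod n 6).symm⟩
    have h1 := Nat.unpair_left_le m
    have h2 := Nat.unpair_right_le m
    interval_cases r
    · obtain ⟨s, hs⟩ := termCode_surjective (Nat.unpair m).1
      obtain ⟨t, ht⟩ := termCode_surjective (Nat.unpair m).2
      exact ⟨.equal s t, by simp [code, hs, ht]⟩
    · obtain ⟨ts, hts⟩ := (termCode_surjective_aux (Nat.unpair m).2).2
      refine ⟨Fml.rel (L := arith) (n := ts.length) (Nat.unpair m).1 ts.get, ?_⟩
      have h1 : (List.ofFn fun i => termCode (ts.get i)) = ts.map termCode := by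
        rw [← Function.comp_def termCode, ← List.map_ofFn, List.ofFn_get]
      simp only [code, h1, hts]
      simp
    · obtain ⟨φ, hφ⟩ := ih m (by omega)
      exact ⟨.neg φ, by simp [code, hφ]⟩
    · obtain ⟨φ, hφ⟩ := ih (Nat.unpair m).1 (by omega)
      obtain ⟨ψ, hψ⟩ := ih (Nat.unpair m).2 (by omega)
      exact ⟨.imp φ ψ, by simp [code, hφ, hψ]⟩
    · obtain ⟨φ, hφ⟩ := ih (Nat.unpair m).2 (by omega)
      exact ⟨.all (Nat.unpair m).1 φ, by simp [code, hφ]⟩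
    · obtain ⟨φ, hφ⟩ := ih (Nat.unpair m).2 (by omega)
      exact ⟨.ex (Nat.unpair m).1 φ, by simp [code, hφ]⟩

/-- Every natural number is the code of exactly one formula. -/
theorem code_bijective : Function.Bijective code := ⟨code_injective, code_surjective⟩

/-! ### The syntactic operations as terms of arithmetic

These follow the clauses of `listCode`, `termCode` and `code`. -/

/-- the list with head `s` and tail `t` -/
def consD (s t : Tm) : Tm := suc (pair s t)
/-- the variable of index `t` -/
def varD (t : Tm) : Tm := mul two t
/-- the application of the function symbol of index `s` to the list `t` of terms -/
def funcD (s t : Tm) : Tm := suc (mul two (pair s t))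
/-- `6 * t + r` -/
def nodeD (r : ℕ) (t : Tm) : Tm := add (mul (numeral 6) t) (numeral r)
/-- the equation between the terms `s` and `t` -/
def eqD (s t : Tm) : Tm := nodeD 0 (pair s t)
/-- the relation symbol of index `s`, applied to the list `t` of terms -/
def relD (s t : Tm) : Tm := nodeD 1 (pair s t)
/-- the negation of the formula `t` -/
def negD (t : Tm) : Tm := nodeD 2 t
/-- the implication from the formula `s` to the formula `t` -/
def impD (s t : Tm) : Tm := nodeD 3 (pair s t)
/-- the universal quantification of the formula `t` over the variable of index `s` -/
def allD (s t : Tm) : Tm := nodeD 4 (pair s t)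
/-- the existential quantification of the formula `t` over the variable of index `s` -/
def exD (s t : Tm) : Tm := nodeD 5 (pair s t)
/-- the term `S t` -/
def sucD (t : Tm) : Tm := funcD (numeral 0) (consD t zero)
/-- the term `SS0 * t` -/
def dblD (t : Tm) : Tm :=
  funcD (numeral 1) (consD (numeral (termCode two)) (consD t zero))

/-! ### Elementary arithmetic -/

/-- The number of named function symbols of each arity. -/
def baseFun : ℕ → ℕ
  | 0 => 1
  | 1 => 3
  | 2 => 4
  | 3 => 3
  | _ => 0

/-- The number of named relation symbols of each arity. -/
def baseRel : ℕ → ℕ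
  | 2 => 4
  | 3 => 1
  | _ => 0

/-- Terms in the named function symbols. -/
inductive BaseTm : Tm → Prop
  | var (i : ℕ) : BaseTm (va i)
  | func {k : ℕ} (i : ℕ) (hi : i < baseFun k) (ts : Fin k → Tm) (h : ∀ j, BaseTm (ts j)) :
      BaseTm (FirstOrder.Language.Term.func (L := arith) (l := k) i ts)

/-- Bounded formulas in the named symbols. -/
inductive Delta0 : Fml arith → Prop
  | equal (s t : Tm) (hs : BaseTm s) (ht : BaseTm t) : Delta0 (.equal s t)
  | rel {k : ℕ} (i : ℕ) (hi : i < baseRel k) (ts : Fin k → Tm) (h : ∀ j, BaseTm (ts j)) :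
      Delta0 (Fml.rel (L := arith) (n := k) i ts)
  | neg (φ : Fml arith) (h : Delta0 φ) : Delta0 (.neg φ)
  | imp (φ ψ : Fml arith) (h₁ : Delta0 φ) (h₂ : Delta0 ψ) : Delta0 (.imp φ ψ)
  | ball (v : ℕ) (t : Tm) (φ : Fml arith) (ht : BaseTm t) (hv : v ∉ t.varFinset)
      (h : Delta0 φ) : Delta0 (.all v (.imp (le (va v) t) φ))
  | bex (v : ℕ) (t : Tm) (φ : Fml arith) (ht : BaseTm t) (hv : v ∉ t.varFinset)
      (h : Delta0 φ) : Delta0 (.ex v (.and (le (va v) t) φ))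

/-- The axioms of elementary arithmetic `IΔ₀ + exp`, with function and relation symbols for
the elementary syntactic operations. The axioms for the latter are recursive definitions of these
operations on codes; their graphs are bounded-definable and their values are bounded by terms in
`exp`, so that this is an extension of `IΔ₀ + exp` by definitions. -/
inductive EA : Set (Fml arith)
  -- successor, addition, multiplication, order, exponentiation
  | suc_ne_zero : EA (.neg (eq (suc (va 0)) zero))
  | suc_inj : EA (.imp (eq (suc (va 0)) (suc (va 1))) (eq (va 0) (va 1)))
  | add_zero : EA (eq (add (va 0) zero) (va 0))
  | add_suc : EA (eq (add (va 0) (suc (va 1))) (suc (add (va 0) (va 1))))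
  | mul_zero : EA (eq (mul (va 0) zero) zero)
  | mul_suc : EA (eq (mul (va 0) (suc (va 1))) (add (mul (va 0) (va 1)) (va 0)))
  | le_iff : EA (.iff (le (va 0) (va 1)) (.ex 2 (eq (add (va 2) (va 0)) (va 1))))
  | exp_zero : EA (eq (expo zero) (suc zero))
  | exp_suc : EA (eq (expo (suc (va 0))) (add (expo (va 0)) (expo (va 0))))
  -- induction for bounded formulas, with parameters
  | induction (φ : Fml arith) (h : Delta0 φ) (v : ℕ) :
      EA (.imp (φ.sub v zero)
        (.imp (.all v (.imp φ (φ.sub v (suc (va v))))) (.all v φ)))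
  -- pairing and lists
  | pair_lt : EA (.imp (le (suc (va 0)) (va 1))
      (eq (pair (va 0) (va 1)) (add (mul (va 1) (va 1)) (va 0))))
  | pair_ge : EA (.imp (le (va 1) (va 0))
      (eq (pair (va 0) (va 1)) (add (add (mul (va 0) (va 0)) (va 0)) (va 1))))
  | drop_zero : EA (eq (drop (va 0) zero) (va 0))
  | drop_nil : EA (eq (drop zero (va 0)) zero)
  | drop_cons : EA (eq (drop (consD (va 0) (va 1)) (suc (va 2))) (drop (va 1) (va 2)))
  -- the code of the numeral of a number
  | num_zero : EA (eq (numD zero) (numeral (termCode zero)))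
  | num_even : EA (.imp (.neg (eq (va 0) zero))
      (eq (numD (mul two (va 0))) (dblD (numD (va 0)))))
  | num_odd : EA (eq (numD (suc (mul two (va 0)))) (sucD (dblD (numD (va 0)))))
  -- substitution of the term `v₃` for the variable of index `v₂`
  | subT_var_eq : EA (eq (subT (varD (va 2)) (va 2) (va 3)) (va 3))
  | subT_var_ne : EA (.imp (.neg (eq (va 0) (va 2)))
      (eq (subT (varD (va 0)) (va 2) (va 3)) (varD (va 0))))
  | subT_func : EA (eq (subT (funcD (va 0) (va 1)) (va 2) (va 3))
      (funcD (va 0) (subL (va 1) (va 2) (va 3))))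
  | subL_nil : EA (eq (subL zero (va 2) (va 3)) zero)
  | subL_cons : EA (eq (subL (consD (va 0) (va 1)) (va 2) (va 3))
      (consD (subT (va 0) (va 2) (va 3)) (subL (va 1) (va 2) (va 3))))
  | subF_eq : EA (eq (subF (eqD (va 0) (va 1)) (va 2) (va 3))
      (eqD (subT (va 0) (va 2) (va 3)) (subT (va 1) (va 2) (va 3))))
  | subF_rel : EA (eq (subF (relD (va 0) (va 1)) (va 2) (va 3))
      (relD (va 0) (subL (va 1) (va 2) (va 3))))
  | subF_neg : EA (eq (subF (negD (va 0)) (va 2) (va 3)) (negD (subF (va 0) (va 2) (va 3))))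
  | subF_imp : EA (eq (subF (impD (va 0) (va 1)) (va 2) (va 3))
      (impD (subF (va 0) (va 2) (va 3)) (subF (va 1) (va 2) (va 3))))
  | subF_all_eq : EA (eq (subF (allD (va 2) (va 1)) (va 2) (va 3)) (allD (va 2) (va 1)))
  | subF_all_ne : EA (.imp (.neg (eq (va 0) (va 2)))
      (eq (subF (allD (va 0) (va 1)) (va 2) (va 3))
        (allD (va 0) (subF (va 1) (va 2) (va 3)))))
  | subF_ex_eq : EA (eq (subF (exD (va 2) (va 1)) (va 2) (va 3)) (exD (va 2) (va 1)))
  | subF_ex_ne : EA (.imp (.neg (eq (va 0) (va 2)))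
      (eq (subF (exD (va 0) (va 1)) (va 2) (va 3))
        (exD (va 0) (subF (va 1) (va 2) (va 3)))))
  -- the variable of index `v₂` is free
  | freeT_var : EA (.iff (freeT (va 2) (varD (va 0))) (eq (va 2) (va 0)))
  | freeT_func : EA (.iff (freeT (va 2) (funcD (va 0) (va 1))) (freeL (va 2) (va 1)))
  | freeL_nil : EA (.neg (freeL (va 2) zero))
  | freeL_cons : EA (.iff (freeL (va 2) (consD (va 0) (va 1)))
      (.or (freeT (va 2) (va 0)) (freeL (va 2) (va 1))))
  | freeF_eq : EA (.iff (freeF (va 2) (eqD (va 0) (va 1)))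
      (.or (freeT (va 2) (va 0)) (freeT (va 2) (va 1))))
  | freeF_rel : EA (.iff (freeF (va 2) (relD (va 0) (va 1))) (freeL (va 2) (va 1)))
  | freeF_neg : EA (.iff (freeF (va 2) (negD (va 0))) (freeF (va 2) (va 0)))
  | freeF_imp : EA (.iff (freeF (va 2) (impD (va 0) (va 1)))
      (.or (freeF (va 2) (va 0)) (freeF (va 2) (va 1))))
  | freeF_all : EA (.iff (freeF (va 2) (allD (va 0) (va 1)))
      (.and (.neg (eq (va 2) (va 0))) (freeF (va 2) (va 1))))
  | freeF_ex : EA (.iff (freeF (va 2) (exD (va 0) (va 1)))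
      (.and (.neg (eq (va 2) (va 0))) (freeF (va 2) (va 1))))
  -- the term `v₃` is free for the variable of index `v₂`
  | freeFor_eq : EA (freeFor (va 3) (va 2) (eqD (va 0) (va 1)))
  | freeFor_rel : EA (freeFor (va 3) (va 2) (relD (va 0) (va 1)))
  | freeFor_neg : EA (.iff (freeFor (va 3) (va 2) (negD (va 0)))
      (freeFor (va 3) (va 2) (va 0)))
  | freeFor_imp : EA (.iff (freeFor (va 3) (va 2) (impD (va 0) (va 1)))
      (.and (freeFor (va 3) (va 2) (va 0)) (freeFor (va 3) (va 2) (va 1))))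
  | freeFor_all : EA (.iff (freeFor (va 3) (va 2) (allD (va 0) (va 1)))
      (.imp (freeF (va 2) (allD (va 0) (va 1)))
        (.and (.neg (freeT (va 0) (va 3))) (freeFor (va 3) (va 2) (va 1)))))
  | freeFor_ex : EA (.iff (freeFor (va 3) (va 2) (exD (va 0) (va 1)))
      (.imp (freeF (va 2) (exD (va 0) (va 1)))
        (.and (.neg (freeT (va 0) (va 3))) (freeFor (va 3) (va 2) (va 1)))))

/-! ### The provability predicate -/

/-- `α` numerates the axioms of `T` in `S`: `α` has no free variable except `v₀`, and
`S ⊢ α(⌜φ⌝)` exactly for the axioms `φ` of `T`. -/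
def Numerates (α : Fml arith) (T S : Set (Fml arith)) : Prop :=
  α.fv ⊆ {0} ∧ ∀ φ : Fml arith, Provable S (α.sub 0 (numeral (code φ))) ↔ φ ∈ T

/-- For a formula `φ(v₀)` with no other free variable and a term `t` without `v₀`, the formula
`φ(t)`, written `∃ v₀ (v₀ = t ∧ φ)` so that no variable of `t` is captured. -/
def app (φ : Fml arith) (t : Tm) : Fml arith := .ex 0 (.and (eq (va 0) t) φ)

/-- Existential quantification over several variables, all bounded by `t`. -/
def bexs : List ℕ → Tm → Fml arith → Fml arith
  | [], _, φ => φ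
  | v :: vs, t, φ => .ex v (.and (le (va v) t) (bexs vs t φ))

/-- Universal quantification over several variables, all bounded by `t`. -/
def balls : List ℕ → Tm → Fml arith → Fml arith
  | [], _, φ => φ
  | v :: vs, t, φ => .all v (.imp (le (va v) t) (balls vs t φ))

/-- Disjunction of a list of formulas. -/
def ors : List (Fml arith) → Fml arith
  | [] => .neg (eq zero zero)
  | φ :: l => .or φ (ors l)

/-- Conjunction of a list of formulas. -/
def ands : List (Fml arith) → Fml arith
  | [] => eq zero zero
  | φ :: l => .and φ (ands l)

/-- The formula (coded by) `z` is a logical axiom, clause by clause as in `LogicalAxiom`. The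
term `z` must not contain the variables `v₅, …, v₉`. -/
def logAxD (z : Tm) : Fml arith :=
  ors [
    bexs [5, 6] z (eq z (impD (va 5) (impD (va 6) (va 5)))),
    bexs [5, 6, 7] z (eq z (impD (impD (va 5) (impD (va 6) (va 7)))
      (impD (impD (va 5) (va 6)) (impD (va 5) (va 7))))),
    bexs [5, 6] z (eq z (impD (impD (negD (va 5)) (negD (va 6))) (impD (va 6) (va 5)))),
    bexs [5, 8, 9] z (.and (freeFor (va 9) (va 8) (va 5))
      (eq z (impD (allD (va 8) (va 5)) (subF (va 5) (va 8) (va 9))))),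
    bexs [5, 6, 8] z (.and (.neg (freeF (va 8) (va 5)))
      (eq z (impD (allD (va 8) (impD (va 5) (va 6))) (impD (va 5) (allD (va 8) (va 6)))))),
    bexs [5, 8, 9] z (.and (freeFor (va 9) (va 8) (va 5))
      (eq z (impD (subF (va 5) (va 8) (va 9)) (exD (va 8) (va 5))))),
    bexs [5, 6, 8] z (.and (.neg (freeF (va 8) (va 6)))
      (eq z (impD (allD (va 8) (impD (va 5) (va 6))) (impD (exD (va 8) (va 5)) (va 6))))),
    bexs [9] z (eq z (eqD (va 9) (va 9))),
    bexs [5, 8, 9] z (.and (freeFor (va 9) (va 8) (va 5))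
      (eq z (impD (eqD (varD (va 8)) (va 9))
        (impD (va 5) (subF (va 5) (va 8) (va 9))))))]

/-- The number `a` is an entry of the list `l`. The terms must not contain `v₁₀, v₁₁`. -/
def memD (a l : Tm) : Fml arith := bexs [10, 11] l (eq (drop l (va 10)) (consD a (va 11)))

/-- `Proof_α(v₁)`: the number `v₁` is a list of formulas, the last line first, in which every line
`v₃` with list `v₄` of preceding lines is a logical axiom, an axiom according to `α`, or follows
from preceding lines by modus ponens or generalization. -/
def proofD (α : Fml arith) : Fml arith :=
  balls [2, 3, 4] (va 1) (.imp (eq (drop (va 1) (va 2)) (consD (va 3) (va 4)))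
    (ors [
      logAxD (va 3),
      app α (va 3),
      bexs [5] (va 4) (.and (memD (impD (va 5) (va 3)) (va 4)) (memD (va 5) (va 4))),
      bexs [5, 8] (va 3) (.and (eq (va 3) (allD (va 8) (va 5))) (memD (va 5) (va 4)))]))

/-- `Prf_α(v₀, v₁)`: the number `v₁` is a proof, with axioms in `α`, of the formula `v₀`. -/
def prfD (α : Fml arith) : Fml arith :=
  .and (proofD α) (bexs [2] (va 1) (eq (va 1) (consD (va 0) (va 2))))

/-- `Pr_α(v₀)`: the formula `v₀` is provable with axioms in `α`. -/
def prD (α : Fml arith) : Fml arith := .ex 1 (prfD α)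

/-- `Pr_α(t)`, for a term `t` without `v₀`. -/
def provD (α : Fml arith) (t : Tm) : Fml arith := app (prD α) t

/-- `Formula(t)`: the number `t` is the code of a formula. By `code_bijective` all numbers are. -/
def formulaD (t : Tm) : Fml arith := eq t t

/-! ### The ω-consistency statements -/

/-- Quantifiers. -/
inductive Quant : Type
  | all
  | ex

namespace Quant

/-- The dual quantifier. -/
def dual : Quant → Quant
  | all => ex
  | ex => all

/-- Quantification of a formula. -/
def apply {L : FirstOrder.Language.{0, 0}} : Quant → ℕ → Fml L → Fml L
  | all => Fml.all
  | ex => Fml.ex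

/-- Quantification on codes. -/
def applyD : Quant → Tm → Tm → Tm
  | all => allD
  | ex => exD

end Quant

/-- The object-language variable that stands for (the index of) the `i`-th free variable of the
formula `y`. -/
def vI (i : ℕ) : ℕ := 2 + 2 * i

/-- The object-language variable that stands for the `i`-th numerical argument. -/
def xI (i : ℕ) : ℕ := 3 + 2 * i

/-- `Q₀ x_k. Q₁ x_{k+1}. … φ` -/
def quants : List Quant → ℕ → Fml arith → Fml arith
  | [], _, φ => φ
  | q :: Q, k, φ => q.apply (xI k) (quants Q (k + 1) φ)

/-- The code of the formula `Q₀ w_k. Q₁ w_{k+1}. … φ`, where the variables `w_k, w_{k+1}, …` and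
the formula `φ` are given by their codes. -/
def quantsD : List Quant → ℕ → Tm → Tm
  | [], _, t => t
  | q :: Q, k, t => q.applyD (va (vI k)) (quantsD Q (k + 1) t)

/-- `s(y, x_k, …, x_{k+n-1})`: in the formula (coded by) `y`, the numerals of `x_k, …, x_{k+n-1}`
are substituted for the variables `w_k, …, w_{k+n-1}`. As numerals are closed, this
is done one variable at a time. -/
def numSub : ℕ → ℕ → Tm → Tm
  | 0, _, y => y
  | n + 1, k, y => numSub n (k + 1) (subF y (va (vI k)) (numD (va (xI k))))

/-- `y` is a formula with exactly `n` free variables, namely the distinct variables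
`w_0, …, w_{n-1}`. The term `y` must not contain `v₀`. -/
def nVarD (n : ℕ) (y : Tm) : Fml arith :=
  .and (formulaD y)
    (.and
      (ands ((List.range n).flatMap fun j => (List.range j).map fun i =>
        .neg (eq (va (vI i)) (va (vI j)))))
      (.all 0 (.iff (freeF (va 0) y) (ors ((List.range n).map fun i => eq (va 0) (va (vI i)))))))

/-- Universal closure over `w_0, …, w_{n-1}`. -/
def allVars (n : ℕ) (φ : Fml arith) : Fml arith :=
  (List.range n).foldr (fun i ψ => Fml.all (vI i) ψ) φ

/-- The statement `ω-Con^Q_α`: for every formula `y` with exactly `|Q|` free variables, listed as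
`w_0, w_1, …` (in any order): if `Q x. Pr(s(y, x))`, then not `Pr(⌜Q̄ w. ¬ y⌝)`. -/
def omegaCon (α : Fml arith) (Q : List Quant) : Fml arith :=
  .all 1 (allVars Q.length (.imp (nVarD Q.length (va 1))
    (.imp (quants Q 0 (provD α (numSub Q.length 0 (va 1))))
      (.neg (provD α (quantsD (Q.map Quant.dual) 0 (negD (va 1))))))))

/-! ### The theory of truth -/

/-- A single unary relation symbol. -/
inductive TrRel : ℕ → Type
  | tr : TrRel 1

/-- The language of arithmetic with an additional unary predicate. -/
def arithTr : FirstOrder.Language.{0, 0} := arith.sum ⟨fun _ => Empty, TrRel⟩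

/-- The inclusion of the language of arithmetic. -/
def incl : arith →ᴸ arithTr := FirstOrder.Language.LHom.sumInl

/-- The atomic formula `Tr(t)`. -/
def tr (t : Tm) : Fml arithTr :=
  Fml.rel (L := arithTr) (n := 1) (Sum.inr TrRel.tr) ![incl.onTerm t]

/-- The theory `Tr(S)_T`, where the axioms of `T` are given by their numeration `α`. In `A2` and
`A3`, `v₃` is the index of the quantified variable. -/
inductive TrTheory (S : Set (Fml arith)) (α : Fml arith) : Set (Fml arithTr)
  | base (φ : Fml arith) (h : φ ∈ S) : TrTheory S α (φ.lift incl)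
  | A1 : TrTheory S α (.imp ((provD α (va 1)).lift incl) (tr (va 1)))
  | A2 : TrTheory S α (.iff (tr (allD (va 3) (va 1)))
      (.all 0 (tr (subF (va 1) (va 3) (numD (va 0))))))
  | A3 : TrTheory S α (.iff (tr (exD (va 3) (va 1)))
      (.ex 0 (tr (subF (va 1) (va 3) (numD (va 0))))))
  | A4 : TrTheory S α (.iff (tr (negD (va 1))) (.neg (tr (va 1))))
  | A5 : TrTheory S α (.imp (tr (va 1)) ((formulaD (va 1)).lift incl))

end OmegaCon

/-!
Inside `Tr(S)_T`, suppose that `Q x. Pr(s(y, x))` and `Pr(⌜Q̄ w. ¬ y⌝)`. By `A1`, applied below the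
quantifiers, the first gives `Q x. Tr(s(y, x))` (`provable_quants_provD_imp`), and the second gives
`Tr(⌜Q̄ w. ¬ y⌝)`. The truth predicate commutes with quantifiers and negation, so the latter unfolds
to `Q̄ x. ¬ Tr(s(y, x))`, which contradicts the former (`entails_tr_quantsD`). The unfolding
substitutes the numeral of `x₀` for `w₀` in `Q̄₁ w₁ … ¬ y`, and the result has to be `Q̄₁ w₁ … ¬ y'`
with the substitution carried out in `y`; elementary arithmetic proves this from the recursive
clauses for substitution and from the hypothesis that `w₀, w₁, …` are distinct
(`entails_subF_quantsD`). Nothing has to be known about `Pr` beyond `A1`.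

The derivations are carried out in the Hilbert calculus itself. Hypotheses are kept in a list, for
which the deduction theorem holds by definition (`Entails`); generalization over a variable then
requires that it is not free in any formula of the list.
-/

namespace OmegaCon

/-! ### Derivations from a list of hypotheses -/

section Hilbert

variable {L : FirstOrder.Language.{0, 0}} {Γ : Set (Fml L)}

/-- `φ` is derivable over `Γ` from the hypotheses in a list, in the sense that the iterated
implication is provable. The head of the list is the innermost antecedent; the free variables of
hypotheses, unlike those of `Γ`, are parameters. -/
def Entails (Γ : Set (Fml L)) : List (Fml L) → Fml L → Prop
  | [], φ => Provable Γ φ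
  | ψ :: Δ, φ => Entails Γ Δ (.imp ψ φ)

theorem Entails.of_provable {φ : Fml L} (h : Provable Γ φ) (Δ : List (Fml L)) :
    Entails Γ Δ φ := by
  induction Δ generalizing φ with
  | nil => exact h
  | cons χ Δ ih => exact ih (.mp (.logical (.weaken φ χ)) h)

theorem Entails.mp {Δ : List (Fml L)} {φ ψ : Fml L} (h₁ : Entails Γ Δ (.imp φ ψ))
    (h₂ : Entails Γ Δ φ) : Entails Γ Δ ψ := by
  induction Δ generalizing φ ψ with
  | nil => exact Provable.mp h₁ h₂
  | cons χ Δ ih => exact ih (ih (.of_provable (.logical (.distrib χ φ ψ)) Δ) h₁) h₂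

theorem Entails.weaken {Δ : List (Fml L)} {φ : Fml L} (χ : Fml L) (h : Entails Γ Δ φ) :
    Entails Γ (χ :: Δ) φ :=
  Entails.mp (Δ := Δ) (.of_provable (.logical (.weaken φ χ)) Δ) h

theorem provable_imp_self (φ : Fml L) : Provable Γ (.imp φ φ) :=
  .mp (.mp (.logical (.distrib φ (.imp φ φ) φ)) (.logical (.weaken φ (.imp φ φ))))
    (.logical (.weaken φ φ))

theorem Entails.hyp (φ : Fml L) (Δ : List (Fml L)) : Entails Γ (φ :: Δ) φ :=
  .of_provable (provable_imp_self φ) Δ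

theorem Entails.intro {Δ : List (Fml L)} {φ ψ : Fml L} (h : Entails Γ (φ :: Δ) ψ) :
    Entails Γ Δ (.imp φ ψ) := h

theorem Entails.contra {Δ : List (Fml L)} {φ ψ : Fml L}
    (h : Entails Γ Δ (.imp (.neg φ) (.neg ψ))) : Entails Γ Δ (.imp ψ φ) :=
  .mp (.of_provable (.logical (.contra φ ψ)) Δ) h

theorem Entails.exfalso {Δ : List (Fml L)} {φ : Fml L} (ψ : Fml L) (h₁ : Entails Γ Δ φ)
    (h₂ : Entails Γ Δ (.neg φ)) : Entails Γ Δ ψ :=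
  .mp (.contra (.weaken (.neg ψ) h₂)) h₁

theorem Entails.of_neg_neg {Δ : List (Fml L)} {φ : Fml L} (h : Entails Γ Δ (.neg (.neg φ))) :
    Entails Γ Δ φ :=
  .mp (.contra (.contra (.weaken (.neg (.neg (.neg (.neg φ)))) h))) h

theorem Entails.neg_intro {Δ : List (Fml L)} {φ ψ : Fml L} (h₁ : Entails Γ (φ :: Δ) ψ)
    (h₂ : Entails Γ (φ :: Δ) (.neg ψ)) : Entails Γ Δ (.neg φ) := by
  have h₃ : Entails Γ Δ (.imp φ (.neg (.imp φ φ))) :=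
    Entails.exfalso (Δ := φ :: Δ) _ h₁ h₂
  have h₄ : Entails Γ (.neg (.neg φ) :: Δ) φ := .of_neg_neg (.hyp _ Δ)
  exact .mp (.contra (.intro (.mp (.weaken _ h₃) h₄))) (.of_provable (provable_imp_self φ) Δ)

theorem Entails.and_left {Δ : List (Fml L)} {φ ψ : Fml L} (h : Entails Γ Δ (φ.and ψ)) :
    Entails Γ Δ φ := by
  refine .of_neg_neg (.neg_intro (ψ := .imp φ (.neg ψ)) (.intro ?_) (.weaken _ h))
  exact .exfalso _ (.hyp _ _) (.weaken _ (.hyp _ _))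

theorem Entails.and_right {Δ : List (Fml L)} {φ ψ : Fml L} (h : Entails Γ Δ (φ.and ψ)) :
    Entails Γ Δ ψ :=
  .of_neg_neg (.neg_intro (ψ := .imp φ (.neg ψ)) (.intro (.weaken _ (.hyp _ _))) (.weaken _ h))

theorem Entails.gen {Δ : List (Fml L)} {φ : Fml L} {v : ℕ} (hv : ∀ ψ ∈ Δ, v ∉ ψ.fv)
    (h : Entails Γ Δ φ) : Entails Γ Δ (.all v φ) := by
  induction Δ generalizing φ with
  | nil => exact Provable.gen v h
  | cons χ Δ ih =>
    exact Entails.mp (Δ := Δ) (.of_provable (.logical (.allImp χ φ v (hv χ (by simp)))) Δ)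
      (ih (fun ψ hψ => hv ψ (by simp [hψ])) h)

theorem Entails.ex_elim {Δ : List (Fml L)} {φ ψ : Fml L} {v : ℕ} (hv : ∀ χ ∈ Δ, v ∉ χ.fv)
    (hψ : v ∉ ψ.fv) (h : Entails Γ (φ :: Δ) ψ) : Entails Γ (.ex v φ :: Δ) ψ :=
  Entails.mp (Δ := Δ) (.of_provable (.logical (.exImp φ ψ v hψ)) Δ) (.gen (Δ := Δ) hv h)

/-! ### Substitution -/

theorem subTm_var (t : L.Term ℕ) (v : ℕ) : Fml.subTm t v (.var v) = t := by
  rw [Fml.subTm, Function.update_eq_self]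
  induction t with
  | var => rfl
  | func f ts ih => simp only [FirstOrder.Language.Term.subst, ih]

theorem sub_var (φ : Fml L) (v : ℕ) : φ.sub v (.var v) = φ := by
  induction φ <;> simp_all [Fml.sub, subTm_var]

theorem freeFor_var (φ : Fml L) (v : ℕ) : φ.FreeFor (.var v) v := by
  induction φ with
  | equal | rel => trivial
  | neg φ ih => exact ih
  | imp φ ψ ih₁ ih₂ => exact ⟨ih₁, ih₂⟩
  | all u φ ih => exact fun h => ⟨by simp [Fml.fv] at h ⊢; exact Ne.symm h.1, ih⟩
  | ex u φ ih => exact fun h => ⟨by simp [Fml.fv] at h ⊢; exact Ne.symm h.1, ih⟩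

theorem subTm_of_notMem {t : L.Term ℕ} {v : ℕ} (s : L.Term ℕ) (h : v ∉ t.varFinset) :
    Fml.subTm t v s = t := by
  induction t with
  | var i =>
    have hi : i ≠ v := by simpa [eq_comm] using h
    simp [Fml.subTm, Function.update_of_ne hi]
  | func f ts ih =>
    simp only [FirstOrder.Language.Term.varFinset, Finset.mem_biUnion, Finset.mem_univ, true_and,
      not_exists] at h
    simp only [Fml.subTm, FirstOrder.Language.Term.subst] at ih ⊢
    congr 1
    exact funext fun i => ih i (h i)

theorem Entails.all_elim {Δ : List (Fml L)} {φ : Fml L} {v : ℕ} (h : Entails Γ Δ (.all v φ)) :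
    Entails Γ Δ φ := by
  have h₁ := LogicalAxiom.allInst φ v (.var v) (freeFor_var φ v)
  rw [sub_var] at h₁
  exact .mp (.of_provable (.logical h₁) Δ) h

theorem Entails.ex_intro {Δ : List (Fml L)} {φ : Fml L} {v : ℕ} (h : Entails Γ Δ φ) :
    Entails Γ Δ (.ex v φ) := by
  have h₁ := LogicalAxiom.exInst φ v (.var v) (freeFor_var φ v)
  rw [sub_var] at h₁
  exact .mp (.of_provable (.logical h₁) Δ) h

theorem Provable.sub {φ : Fml L} (h : Provable Γ φ) (v : ℕ) (t : L.Term ℕ)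
    (ht : φ.FreeFor t v) : Provable Γ (φ.sub v t) :=
  .mp (.logical (.allInst φ v t ht)) (.gen v h)

/-- Leibniz's law for equations. The variable `v` marks the place that is rewritten. -/
theorem Entails.rewrite_equal {Δ : List (Fml L)} {a b s t : L.Term ℕ} {v : ℕ}
    (ht : v ∉ t.varFinset) (h : Entails Γ Δ (.equal s t))
    (h' : Entails Γ Δ (.equal (Fml.subTm a v s) (Fml.subTm b v s)))
    (hv : v ∉ (Fml.subTm a v t).varFinset ∧ v ∉ (Fml.subTm b v t).varFinset) :
    Entails Γ Δ (.equal (Fml.subTm a v t) (Fml.subTm b v t)) := by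
  have h₁ : Provable Γ _ := .logical (.eqSubst (.equal a b) v t trivial)
  have h₂ := h₁.sub v s ⟨trivial, trivial, trivial⟩
  simp only [Fml.sub, subTm_of_notMem s ht, subTm_of_notMem s hv.1, subTm_of_notMem s hv.2] at h₂
  have h₃ : Fml.subTm (.var v) v s = s := by simp [Fml.subTm]
  rw [h₃] at h₂
  exact .mp (.mp (.of_provable h₂ Δ) h) h'

/-- Leibniz's law for atomic formulas in a unary relation symbol. -/
theorem Entails.rewrite_rel {Δ : List (Fml L)} {s t : L.Term ℕ} (R : L.Relations 1)
    (h : Entails Γ Δ (.equal s t)) (h' : Entails Γ Δ (.rel R ![s])) :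
    Entails Γ Δ (.rel R ![t]) := by
  obtain ⟨v, hv⟩ := Infinite.exists_notMem_finset t.varFinset
  have h₁ : Provable Γ _ := .logical (.eqSubst (.rel R ![.var v]) v t trivial)
  have h₂ := h₁.sub v s ⟨trivial, trivial, trivial⟩
  have h₃ : ∀ u : L.Term ℕ, Fml.subTm (.var v) v u = u := fun u => by simp [Fml.subTm]
  simp only [Fml.sub, subTm_of_notMem s hv, Matrix.cons_val_fin_one, h₃] at h₂
  have h₄ : ∀ u : L.Term ℕ, (fun _ : Fin 1 => u) = ![u] := fun u => by
    ext i; simp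
  simp only [h₄] at h₂
  exact .mp (.mp (.of_provable h₂ Δ) h) h'

theorem Entails.equal_symm {Δ : List (Fml L)} {s t : L.Term ℕ}
    (h : Entails Γ Δ (.equal s t)) : Entails Γ Δ (.equal t s) := by
  obtain ⟨v, hv⟩ := Infinite.exists_notMem_finset (s.varFinset ∪ t.varFinset)
  rw [Finset.mem_union, not_or] at hv
  have h₃ : ∀ u : L.Term ℕ, Fml.subTm (.var v) v u = u := fun u => by simp [Fml.subTm]
  have h₁ := Entails.rewrite_equal (a := .var v) (b := s) hv.2 h
  simp only [h₃, subTm_of_notMem _ hv.1] at h₁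
  exact h₁ (.of_provable (.logical (.eqRefl s)) Δ) ⟨hv.2, hv.1⟩

theorem Entails.equal_trans {Δ : List (Fml L)} {r s t : L.Term ℕ}
    (h : Entails Γ Δ (.equal r s)) (h' : Entails Γ Δ (.equal s t)) :
    Entails Γ Δ (.equal r t) := by
  obtain ⟨v, hv⟩ := Infinite.exists_notMem_finset (r.varFinset ∪ t.varFinset)
  rw [Finset.mem_union, not_or] at hv
  have h₃ : ∀ u : L.Term ℕ, Fml.subTm (.var v) v u = u := fun u => by simp [Fml.subTm]
  have h₁ := Entails.rewrite_equal (a := r) (b := .var v) hv.2 h'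
  simp only [h₃, subTm_of_notMem _ hv.1] at h₁
  exact h₁ h hv

/-! ### Translation into an extended language -/

variable {L' : FirstOrder.Language.{0, 0}} (g : L →ᴸ L')

theorem varFinset_onTerm (t : L.Term ℕ) : (g.onTerm t).varFinset = t.varFinset := by
  induction t with
  | var => rfl
  | func f ts ih =>
    simp [FirstOrder.Language.LHom.onTerm, FirstOrder.Language.Term.varFinset, ih]

theorem onTerm_subTm (t : L.Term ℕ) (v : ℕ) (s : L.Term ℕ) :
    g.onTerm (Fml.subTm t v s) = Fml.subTm (g.onTerm t) v (g.onTerm s) := by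
  induction t with
  | var i => by_cases h : i = v <;> simp [Fml.subTm, h, FirstOrder.Language.LHom.onTerm]
  | func f ts ih =>
    simp only [Fml.subTm, FirstOrder.Language.Term.subst, FirstOrder.Language.LHom.onTerm] at ih ⊢
    simp [ih]

theorem fv_lift (φ : Fml L) : (φ.lift g).fv = φ.fv := by
  induction φ <;> simp_all [Fml.lift, Fml.fv, varFinset_onTerm]

theorem lift_sub (φ : Fml L) (v : ℕ) (s : L.Term ℕ) :
    (φ.sub v s).lift g = (φ.lift g).sub v (g.onTerm s) := by
  induction φ with
  | all u φ ih => by_cases h : u = v <;> simp [Fml.lift, Fml.sub, h, ih]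
  | ex u φ ih => by_cases h : u = v <;> simp [Fml.lift, Fml.sub, h, ih]
  | _ => simp_all [Fml.lift, Fml.sub, onTerm_subTm]

theorem freeFor_lift {φ : Fml L} {v : ℕ} {s : L.Term ℕ} (h : φ.FreeFor s v) :
    (φ.lift g).FreeFor (g.onTerm s) v := by
  induction φ with
  | equal | rel => trivial
  | neg φ ih => exact ih h
  | imp φ ψ ih₁ ih₂ => exact ⟨ih₁ h.1, ih₂ h.2⟩
  | all u φ ih =>
    intro hv
    rw [← Fml.lift, fv_lift] at hv
    rw [varFinset_onTerm]
    exact ⟨(h hv).1, ih (h hv).2⟩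
  | ex u φ ih =>
    intro hv
    rw [← Fml.lift, fv_lift] at hv
    rw [varFinset_onTerm]
    exact ⟨(h hv).1, ih (h hv).2⟩

theorem LogicalAxiom.lift {φ : Fml L} (h : LogicalAxiom φ) : LogicalAxiom (φ.lift g) := by
  cases h with
  | weaken => exact .weaken _ _
  | distrib => exact .distrib _ _ _
  | contra => exact .contra _ _
  | allInst φ v t h =>
    simp only [Fml.lift, lift_sub]; exact .allInst _ _ _ (freeFor_lift g h)
  | allImp φ ψ v h => exact .allImp _ _ _ (by rwa [fv_lift])
  | exInst φ v t h =>
    simp only [Fml.lift, lift_sub]; exact .exInst _ _ _ (freeFor_lift g h)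
  | exImp φ ψ v h => exact .exImp _ _ _ (by rwa [fv_lift])
  | eqRefl => exact .eqRefl _
  | eqSubst φ v t h =>
    simp only [Fml.lift, lift_sub]; exact .eqSubst _ _ _ (freeFor_lift g h)

theorem Provable.lift {Γ' : Set (Fml L')} (hΓ : ∀ φ ∈ Γ, Provable Γ' (φ.lift g)) {φ : Fml L}
    (h : Provable Γ φ) : Provable Γ' (φ.lift g) := by
  induction h with
  | ax h => exact hΓ _ h
  | logical h => exact .logical (h.lift g)
  | mp _ _ ih₁ ih₂ => exact .mp ih₁ ih₂
  | gen v _ ih => exact .gen v ih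

end Hilbert

/-! ### Substitution and variables in terms of arithmetic -/

section Terms

@[simp] theorem subTm_va_self (i : ℕ) (s : Tm) : Fml.subTm (va i) i s = s := by
  simp [Fml.subTm, va]

theorem subTm_va_of_ne {i v : ℕ} (h : i ≠ v) (s : Tm) : Fml.subTm (va i) v s = va i := by
  simp [Fml.subTm, va, h]

@[simp] theorem subTm_fn1 (i : ℕ) (a : Tm) (v : ℕ) (s : Tm) :
    Fml.subTm (fn1 i a) v s = fn1 i (Fml.subTm a v s) := by
  simp only [Fml.subTm, fn1, FirstOrder.Language.Term.subst]
  congr 1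
  ext j; fin_cases j; rfl

@[simp] theorem subTm_fn2 (i : ℕ) (a b : Tm) (v : ℕ) (s : Tm) :
    Fml.subTm (fn2 i a b) v s = fn2 i (Fml.subTm a v s) (Fml.subTm b v s) := by
  simp only [Fml.subTm, fn2, FirstOrder.Language.Term.subst]
  congr 1
  ext j; fin_cases j <;> rfl

@[simp] theorem subTm_fn3 (i : ℕ) (a b c : Tm) (v : ℕ) (s : Tm) :
    Fml.subTm (fn3 i a b c) v s = fn3 i (Fml.subTm a v s) (Fml.subTm b v s) (Fml.subTm c v s) := by
  simp only [Fml.subTm, fn3, FirstOrder.Language.Term.subst]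
  congr 1
  ext j; fin_cases j <;> rfl

@[simp] theorem mem_varFinset_va (i j : ℕ) : i ∈ (va j).varFinset ↔ i = j := by
  simp [va]

@[simp] theorem notMem_varFinset_fn0 (i j : ℕ) : i ∉ (fn0 j).varFinset := by
  simp [fn0, FirstOrder.Language.Term.varFinset]

@[simp] theorem mem_varFinset_fn1 (i j : ℕ) (a : Tm) :
    i ∈ (fn1 j a).varFinset ↔ i ∈ a.varFinset := by
  simp [fn1, FirstOrder.Language.Term.varFinset]

@[simp] theorem mem_varFinset_fn2 (i j : ℕ) (a b : Tm) :
    i ∈ (fn2 j a b).varFinset ↔ i ∈ a.varFinset ∨ i ∈ b.varFinset := by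
  simp [fn2, FirstOrder.Language.Term.varFinset, Fin.exists_fin_two]

@[simp] theorem mem_varFinset_fn3 (i j : ℕ) (a b c : Tm) :
    i ∈ (fn3 j a b c).varFinset ↔ i ∈ a.varFinset ∨ i ∈ b.varFinset ∨ i ∈ c.varFinset := by
  simp [fn3, FirstOrder.Language.Term.varFinset, Fin.exists_fin_succ]

@[simp] theorem notMem_varFinset_numeral (i n : ℕ) : i ∉ (numeral n).varFinset := by
  induction n using Nat.strong_induction_on with
  | _ n ih =>
    cases n with
    | zero => simp [numeral, zero]
    | succ n =>
      have h := ih ((n + 1) / 2) (by omega)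
      rw [numeral]
      split <;> simp [mul, suc, two, zero, h]

@[simp] theorem subTm_numeral (n v : ℕ) (s : Tm) : Fml.subTm (numeral n) v s = numeral n :=
  subTm_of_notMem s (notMem_varFinset_numeral v n)

@[simp] theorem subTm_numD (a : Tm) (v : ℕ) (s : Tm) :
    Fml.subTm (numD a) v s = numD (Fml.subTm a v s) := subTm_fn1 ..

@[simp] theorem subTm_subF (a b c : Tm) (v : ℕ) (s : Tm) :
    Fml.subTm (subF a b c) v s = subF (Fml.subTm a v s) (Fml.subTm b v s) (Fml.subTm c v s) :=
  subTm_fn3 ..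

@[simp] theorem subTm_nodeD (r : ℕ) (a : Tm) (v : ℕ) (s : Tm) :
    Fml.subTm (nodeD r a) v s = nodeD r (Fml.subTm a v s) := by
  simp [nodeD, add, mul]

@[simp] theorem subTm_negD (a : Tm) (v : ℕ) (s : Tm) :
    Fml.subTm (negD a) v s = negD (Fml.subTm a v s) := subTm_nodeD ..

@[simp] theorem subTm_applyD (q : Quant) (a b : Tm) (v : ℕ) (s : Tm) :
    Fml.subTm (q.applyD a b) v s = q.applyD (Fml.subTm a v s) (Fml.subTm b v s) := by
  cases q <;> simp [Quant.applyD, allD, exD, pair]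

@[simp] theorem mem_varFinset_numD (i : ℕ) (a : Tm) :
    i ∈ (numD a).varFinset ↔ i ∈ a.varFinset := mem_varFinset_fn1 ..

@[simp] theorem mem_varFinset_subF (i : ℕ) (a b c : Tm) :
    i ∈ (subF a b c).varFinset ↔ i ∈ a.varFinset ∨ i ∈ b.varFinset ∨ i ∈ c.varFinset :=
  mem_varFinset_fn3 ..

@[simp] theorem mem_varFinset_nodeD (i r : ℕ) (a : Tm) :
    i ∈ (nodeD r a).varFinset ↔ i ∈ a.varFinset := by
  simp [nodeD, add, mul]

@[simp] theorem mem_varFinset_negD (i : ℕ) (a : Tm) :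
    i ∈ (negD a).varFinset ↔ i ∈ a.varFinset := mem_varFinset_nodeD ..

@[simp] theorem mem_varFinset_applyD (i : ℕ) (q : Quant) (a b : Tm) :
    i ∈ (q.applyD a b).varFinset ↔ i ∈ a.varFinset ∨ i ∈ b.varFinset := by
  cases q <;> simp [Quant.applyD, allD, exD, pair]

theorem mem_varFinset_quantsD {i : ℕ} {Q : List Quant} {k : ℕ} {t : Tm}
    (h : i ∈ (quantsD Q k t).varFinset) : i ∈ t.varFinset ∨ ∃ j, i = vI j := by
  induction Q generalizing k with
  | nil => exact .inl h
  | cons q Q ih =>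
    rw [quantsD, mem_varFinset_applyD, mem_varFinset_va] at h
    exact h.elim (fun h => .inr ⟨k, h⟩) ih

@[simp] theorem xI_ne_vI (i j : ℕ) : xI i ≠ vI j := by simp only [xI, vI]; omega

@[simp] theorem vI_ne (i : ℕ) : vI i ≠ 0 ∧ 0 ≠ vI i ∧ vI i ≠ 1 ∧ vI i ≠ 3 := by
  simp only [vI]; omega

@[simp] theorem xI_ne (i : ℕ) : xI i ≠ 0 ∧ 0 ≠ xI i ∧ xI i ≠ 1 := by
  simp only [xI]; omega

theorem zero_notMem_varFinset_numSub (n k : ℕ) {t : Tm} (h : 0 ∉ t.varFinset) :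
    0 ∉ (numSub n k t).varFinset := by
  induction n generalizing k t with
  | zero => exact h
  | succ n ih => exact ih (k + 1) (by simp [h])

end Terms

/-! ### Substitution under quantifiers in elementary arithmetic -/

section Arithmetic

variable {Γ : Set (Fml arith)} {Δ : List (Fml arith)}

theorem provable_subF_negD (hΓ : Includes Γ EA) (k : ℕ) (t : Tm) :
    Provable Γ (eq (subF (negD t) (va (vI k)) (numD (va (xI k))))
      (negD (subF t (va (vI k)) (numD (va (xI k)))))) := by
  -- The term `t` may contain `v₂` and `v₃`, so it is substituted last.
  have h := (((hΓ _ .subF_neg).sub 2 (va (vI k)) trivial).sub 3 (numD (va (xI k))) trivial).sub 0 t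
    trivial
  simpa [eq, Fml.sub, subTm_va_of_ne] using h

theorem provable_subF_applyD (hΓ : Includes Γ EA) (q : Quant) (j k : ℕ) (t : Tm) :
    Provable Γ (.imp (.neg (eq (va (vI j)) (va (vI k))))
      (eq (subF (q.applyD (va (vI j)) t) (va (vI k)) (numD (va (xI k))))
        (q.applyD (va (vI j)) (subF t (va (vI k)) (numD (va (xI k))))))) := by
  have h : Provable Γ (.imp (.neg (eq (va 0) (va 2)))
      (eq (subF (q.applyD (va 0) (va 1)) (va 2) (va 3))
        (q.applyD (va 0) (subF (va 1) (va 2) (va 3))))) := by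
    cases q
    · exact hΓ _ .subF_all_ne
    · exact hΓ _ .subF_ex_ne
  -- In this order no substituted term contains a variable that is still to be replaced.
  have h' := (((h.sub 2 (va (vI k)) ⟨trivial, trivial⟩).sub 0 (va (vI j)) ⟨trivial, trivial⟩).sub 3
    (numD (va (xI k))) ⟨trivial, trivial⟩).sub 1 t ⟨trivial, trivial⟩
  simpa [eq, Fml.sub, subTm_va_of_ne] using h'

theorem Entails.equal_applyD (q : Quant) (w : Tm) {s t : Tm} (h : Entails Γ Δ (eq s t)) :
    Entails Γ Δ (eq (q.applyD w s) (q.applyD w t)) := by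
  obtain ⟨v, hv⟩ := Infinite.exists_notMem_finset (w.varFinset ∪ (s.varFinset ∪ t.varFinset))
  simp only [Finset.mem_union, not_or] at hv
  have h₁ := Entails.rewrite_equal (a := q.applyD w s) (b := q.applyD w (va v)) hv.2.2 h
  simp only [subTm_applyD, subTm_va_self, subTm_of_notMem _ hv.1, subTm_of_notMem _ hv.2.1] at h₁
  exact h₁ (.of_provable (.logical (.eqRefl _)) Δ) (by simp [hv])

/-- Substitution for `w_k` commutes with a negation under a block of quantifiers over variables
distinct from `w_k`. -/
theorem entails_subF_quantsD (hΓ : Includes Γ EA) (Q : List Quant) (j k : ℕ) (t : Tm)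
    (hne : ∀ i, j ≤ i → i < j + Q.length → Entails Γ Δ (.neg (eq (va (vI i)) (va (vI k))))) :
    Entails Γ Δ (eq (subF (quantsD Q j (negD t)) (va (vI k)) (numD (va (xI k))))
      (quantsD Q j (negD (subF t (va (vI k)) (numD (va (xI k))))))) := by
  induction Q generalizing j with
  | nil => exact .of_provable (provable_subF_negD hΓ k t) Δ
  | cons q Q ih =>
    rw [List.length_cons] at hne
    exact .equal_trans
      (.mp (.of_provable (provable_subF_applyD hΓ q j k _) Δ) (hne j le_rfl (by omega)))
      (.equal_applyD q _ (ih (j + 1) fun i h₁ h₂ => hne i (by omega) (by omega)))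

theorem entails_of_mem_ands {l : List (Fml arith)} {φ : Fml arith} (hφ : φ ∈ l)
    (h : Entails Γ Δ (ands l)) : Entails Γ Δ φ := by
  induction l with
  | nil => simp at hφ
  | cons ψ l ih =>
    rcases List.mem_cons.1 hφ with rfl | hφ
    · exact h.and_left
    · exact ih hφ h.and_right

theorem entails_nVarD_ne (n : ℕ) {i j : ℕ} (hij : i < j) (hj : j < n) (y : Tm) :
    Entails Γ [nVarD n y] (.neg (eq (va (vI j)) (va (vI i)))) := by
  have h : Entails Γ [nVarD n y] (.neg (eq (va (vI i)) (va (vI j)))) := by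
    refine entails_of_mem_ands ?_ (Entails.hyp (nVarD n y) []).and_right.and_left
    simp only [List.mem_flatMap, List.mem_map, List.mem_range]
    exact ⟨j, hj, i, hij, rfl⟩
  exact .neg_intro (.equal_symm (.hyp _ _)) (.weaken _ h)

theorem exists_of_mem_fv_ands {l : List (Fml arith)} {v : ℕ} (h : v ∈ (ands l).fv) :
    ∃ φ ∈ l, v ∈ φ.fv := by
  induction l with
  | nil => simp [ands, Fml.fv, eq, zero] at h
  | cons φ l ih => simp only [ands, Fml.and, Fml.fv, Finset.mem_union] at h; aesop

theorem exists_of_mem_fv_ors {l : List (Fml arith)} {v : ℕ} (h : v ∈ (ors l).fv) :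
    ∃ φ ∈ l, v ∈ φ.fv := by
  induction l with
  | nil => simp [ors, Fml.fv, eq, zero] at h
  | cons φ l ih => simp only [ors, Fml.or, Fml.fv, Finset.mem_union] at h; aesop

theorem xI_notMem_fv_nVarD (n k : ℕ) : xI k ∉ (nVarD n (va 1)).fv := by
  have hands : xI k ∉ (ands ((List.range n).flatMap fun j => (List.range j).map fun i =>
      .neg (eq (va (vI i)) (va (vI j))))).fv := by
    intro h
    obtain ⟨φ, hφ, h⟩ := exists_of_mem_fv_ands h
    simp only [List.mem_flatMap, List.mem_map] at hφ
    obtain ⟨j, -, i, -, rfl⟩ := hφ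
    simp [Fml.fv, eq] at h
  have hors : xI k ∉ (ors ((List.range n).map fun i => eq (va 0) (va (vI i)))).fv := by
    intro h
    obtain ⟨φ, hφ, h⟩ := exists_of_mem_fv_ors h
    simp only [List.mem_map] at hφ
    obtain ⟨i, -, rfl⟩ := hφ
    simp [Fml.fv, eq] at h
  have heq : xI k ∉ (eq (va 1) (va 1)).fv := by simp [eq, Fml.fv]
  have hfree : xI k ∉ (freeF (va 0) (va 1)).fv := by
    simp [freeF, rl2, Fml.fv, Fin.exists_fin_two]
  simp only [nVarD, formulaD, Fml.and, Fml.iff, Fml.fv, Finset.mem_union, Finset.mem_erase,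
    heq, hands, hors, hfree, or_self, and_false, not_false_eq_true]

end Arithmetic

/-! ### The truth predicate -/

section Truth

variable {S : Set (Fml arith)} {α : Fml arith}

theorem fv_tr (t : Tm) : (tr t).fv = t.varFinset := by
  simp [tr, Fml.fv, varFinset_onTerm]

theorem tr_sub (t : Tm) (v : ℕ) (s : Tm) :
    (tr t).sub v (incl.onTerm s) = tr (Fml.subTm t v s) := by
  simp only [tr, Fml.sub, onTerm_subTm]
  congr 1
  ext i; simp

theorem provable_lift {φ : Fml arith} (h : Provable S φ) :
    Provable (TrTheory S α) (φ.lift incl) :=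
  h.lift incl fun φ hφ => .ax (.base φ hφ)

theorem entails_tr_of_eq {Δ : List (Fml arithTr)} {s t : Tm}
    (h : Entails (TrTheory S α) Δ ((eq s t).lift incl)) (h' : Entails (TrTheory S α) Δ (tr s)) :
    Entails (TrTheory S α) Δ (tr t) :=
  .rewrite_rel _ h h'

theorem provable_provD_imp_tr {t : Tm} (ht : 0 ∉ t.varFinset) :
    Provable (TrTheory S α) (.imp ((provD α t).lift incl) (tr t)) := by
  -- In `∃ v₀ (v₀ = v₁ ∧ ∃ v₁ …)` only the outer occurrence of `v₁` is free.
  have hf : (provD α (va 1)).FreeFor t 1 := by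
    refine fun _ => ⟨ht, trivial, fun h => ?_⟩
    simp [Fml.fv] at h
  have h := (Provable.ax (TrTheory.A1 (S := S) (α := α))).sub 1 (incl.onTerm t)
    ⟨freeFor_lift incl hf, trivial⟩
  have hs : (provD α (va 1)).sub 1 t = provD α t := by
    simp [provD, app, prD, Fml.and, Fml.sub, eq, subTm_va_of_ne]
  rwa [Fml.sub, ← lift_sub, hs, tr_sub, subTm_va_self] at h

theorem provable_tr_negD (t : Tm) :
    Provable (TrTheory S α) (.imp (tr (negD t)) (.neg (tr t))) := by
  have h := (Provable.ax (TrTheory.A4 (S := S) (α := α))).sub 1 (incl.onTerm t)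
    ⟨⟨trivial, trivial⟩, trivial, trivial⟩
  simp only [Fml.iff, Fml.and, Fml.sub, tr_sub, subTm_va_self, subTm_negD] at h
  exact Entails.and_left (Δ := []) h

/-- One step of the unfolding of a true quantified sentence. The bound variable is `x_k`, whereas
it is `v₀` in the axioms. -/
theorem provable_tr_applyD (q : Quant) (k : ℕ) {t : Tm} (h₀ : 0 ∉ t.varFinset)
    (hx : xI k ∉ t.varFinset) :
    Provable (TrTheory S α) (.imp (tr (q.applyD (va (vI k)) t))
      (q.apply (xI k) (tr (subF t (va (vI k)) (numD (va (xI k))))))) := by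
  have hA : Provable (TrTheory S α) (.imp (tr (q.applyD (va (vI k)) t))
      (q.apply 0 (tr (subF t (va (vI k)) (numD (va 0)))))) := by
    have hax : Provable (TrTheory S α) (.iff (tr (q.applyD (va 3) (va 1)))
        (q.apply 0 (tr (subF (va 1) (va 3) (numD (va 0)))))) := by
      cases q
      · exact .ax .A2
      · exact .ax .A3
    have h₁ := Entails.and_left (Δ := []) hax
    have hf₁ : (q.apply 0 (tr (subF (va 1) (va 3) (numD (va 0))))).FreeFor
        (incl.onTerm (va (vI k))) 3 := by
      cases q <;> exact fun _ => ⟨by simp [varFinset_onTerm], trivial⟩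
    have h₂ := Provable.sub h₁ 3 (incl.onTerm (va (vI k))) ⟨trivial, hf₁⟩
    have e₂ : (q.apply 0 (tr (subF (va 1) (va 3) (numD (va 0))))).sub 3 (incl.onTerm (va (vI k))) =
        q.apply 0 (tr (subF (va 1) (va (vI k)) (numD (va 0)))) := by
      cases q <;> simp [Quant.apply, Fml.sub, tr_sub, subTm_va_of_ne]
    rw [Fml.sub, e₂, tr_sub] at h₂
    have hf₂ : (q.apply 0 (tr (subF (va 1) (va (vI k)) (numD (va 0))))).FreeFor
        (incl.onTerm t) 1 := by
      cases q <;> exact fun _ => ⟨by rwa [varFinset_onTerm], trivial⟩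
    have h₃ := Provable.sub h₂ 1 (incl.onTerm t) ⟨trivial, hf₂⟩
    have e₃ : (q.apply 0 (tr (subF (va 1) (va (vI k)) (numD (va 0))))).sub 1 (incl.onTerm t) =
        q.apply 0 (tr (subF t (va (vI k)) (numD (va 0)))) := by
      cases q <;> simp [Quant.apply, Fml.sub, tr_sub, subTm_va_of_ne]
    rw [Fml.sub, e₃, tr_sub] at h₃
    simpa [subTm_va_of_ne] using h₃
  refine Entails.intro (Δ := []) ?_
  have hB : Entails (TrTheory S α) [tr (q.applyD (va (vI k)) t)] _ := hA
  cases q with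
  | all =>
    have h₁ := LogicalAxiom.allInst (tr (subF t (va (vI k)) (numD (va 0)))) 0
      (incl.onTerm (va (xI k))) trivial
    rw [tr_sub] at h₁
    simp only [subTm_subF, subTm_numD, subTm_va_self, subTm_of_notMem _ h₀,
      subTm_va_of_ne (vI_ne k).1] at h₁
    refine .gen ?_ (.mp (.of_provable (.logical h₁) _) hB)
    simp [fv_tr, hx]
  | ex =>
    have h₁ := LogicalAxiom.exInst (tr (subF t (va (vI k)) (numD (va (xI k))))) (xI k)
      (incl.onTerm (va 0)) trivial
    rw [tr_sub] at h₁
    simp only [subTm_subF, subTm_numD, subTm_va_self, subTm_of_notMem _ hx,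
      subTm_va_of_ne (xI_ne_vI k k).symm] at h₁
    refine .mp (.of_provable ?_ _) hB
    refine Entails.ex_elim (Δ := []) (by simp) ?_ (Provable.logical h₁)
    simp [Quant.apply, Fml.fv, fv_tr, h₀]

/-- `Q₀ x_k. Q₁ x_{k+1}. … φ`, in the language with the truth predicate. -/
def quantsTr : List Quant → ℕ → Fml arithTr → Fml arithTr
  | [], _, φ => φ
  | q :: Q, k, φ => q.apply (xI k) (quantsTr Q (k + 1) φ)

theorem provable_quants_provD_imp (Q : List Quant) (k : ℕ) {t : Tm} (ht : 0 ∉ t.varFinset) :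
    Provable (TrTheory S α) (.imp ((quants Q k (provD α t)).lift incl) (quantsTr Q k (tr t))) := by
  induction Q generalizing k with
  | nil => exact provable_provD_imp_tr ht
  | cons q Q ih =>
    refine Entails.intro (Δ := []) ?_
    cases q with
    | all =>
      refine .gen ?_ (.mp (.of_provable (ih (k + 1)) _) (.all_elim (.hyp _ _)))
      intro ψ hψ
      rw [List.mem_singleton.1 hψ, fv_lift]
      exact Finset.notMem_erase _ _
    | ex =>
      refine Entails.ex_elim (Δ := []) (by simp) (by simp [quantsTr, Quant.apply, Fml.fv]) ?_
      exact .ex_intro (.mp (.of_provable (ih (k + 1)) _) (.hyp _ _))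

/-- If the dual quantification of `¬ t` is true, then it is not the case that, with the
quantifiers `Q`, all numerical instances of `t` are true. -/
theorem entails_tr_quantsD (hS : Includes S EA) (n : ℕ) (Q : List Quant) (k : ℕ)
    (hk : k + Q.length ≤ n) {t : Tm} (h₀ : 0 ∉ t.varFinset)
    (hx : ∀ j, k ≤ j → xI j ∉ t.varFinset) :
    Entails (TrTheory S α)
      [tr (quantsD (Q.map Quant.dual) k (negD t)), (nVarD n (va 1)).lift incl]
      (.neg (quantsTr Q k (tr (numSub Q.length k t)))) := by
  induction Q generalizing k t with
  | nil => exact .mp (.of_provable (provable_tr_negD t) _) (.hyp _ _)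
  | cons q Q ih =>
    rw [List.length_cons] at hk
    set C := (nVarD n (va 1)).lift incl with hC
    set u := subF t (va (vI k)) (numD (va (xI k))) with hu
    have hCx : xI k ∉ C.fv := by rw [hC, fv_lift]; exact xI_notMem_fv_nVarD n k
    have hmem : ∀ i, i ∈ (quantsD (Q.map Quant.dual) (k + 1) (negD t)).varFinset →
        i ∈ t.varFinset ∨ ∃ j, i = vI j := fun i hi => by
      simpa using mem_varFinset_quantsD hi
    have hstep := provable_tr_applyD (S := S) (α := α) q.dual k
      (t := quantsD (Q.map Quant.dual) (k + 1) (negD t))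
      (fun h => (hmem _ h).elim h₀ fun ⟨j, hj⟩ => by simp at hj)
      (fun h => (hmem _ h).elim (hx k le_rfl) fun ⟨j, hj⟩ => xI_ne_vI k j hj)
    set B := tr (subF (quantsD (Q.map Quant.dual) (k + 1) (negD t)) (va (vI k)) (numD (va (xI k))))
      with hB
    have ih' := ih (k + 1) (by omega) (t := u) (by simp [hu, h₀]) fun j hj => by
      have h₁ : xI j ≠ xI k := by simp only [xI]; omega
      simp [hu, hx j (by omega), h₁]
    set A := quantsTr Q (k + 1) (tr (numSub Q.length (k + 1) u)) with hA
    have heq : Entails (TrTheory S α) [C] ((eq (subF (quantsD (Q.map Quant.dual) (k + 1) (negD t))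
        (va (vI k)) (numD (va (xI k)))) (quantsD (Q.map Quant.dual) (k + 1) (negD u))).lift incl) :=
      provable_lift (entails_subF_quantsD (Γ := S) (Δ := [nVarD n (va 1)]) hS _ _ _ _
        fun i h₁ h₂ => by
          rw [List.length_map] at h₂
          exact entails_nVarD_ne n (by omega) (by omega) _)
    have hBA : Entails (TrTheory S α) [B, C] (.neg A) :=
      .mp (.weaken _ ih'.intro) (entails_tr_of_eq (.weaken _ heq) (.hyp _ _))
    -- The two cases are `∃ x ¬ A → ¬ ∀ x A` and `∀ x ¬ A → ¬ ∃ x A`.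
    have hmain : Entails (TrTheory S α) [q.dual.apply (xI k) B, C] (.neg (q.apply (xI k) A)) := by
      cases q with
      | all =>
        refine .ex_elim (by simpa using hCx) (by simp [Quant.apply, Fml.fv]) ?_
        exact .neg_intro (.all_elim (.hyp _ _)) (.weaken _ hBA)
      | ex =>
        -- `¬ (C → C)` serves as a contradiction in which `x_k` is not free.
        refine .neg_intro (ψ := .imp C C) (.of_provable (provable_imp_self C) _) ?_
        refine .ex_elim ?_ (by simpa [Fml.fv] using hCx) ?_
        · simp [Quant.dual, Quant.apply, Fml.fv, hCx]
        · have h₁ : Entails (TrTheory S α) [Fml.all (xI k) B, C] (.neg A) :=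
            .mp (.weaken _ hBA.intro) (.all_elim (.hyp _ _))
          exact .exfalso _ (.hyp _ _) (.weaken _ h₁)
    exact .mp (.weaken _ hmain.intro) (.mp (.of_provable hstep _) (.hyp _ _))

theorem provable_lift_allVars (n : ℕ) {φ : Fml arith} {Γ : Set (Fml arithTr)}
    (h : Provable Γ (φ.lift incl)) : Provable Γ ((allVars n φ).lift incl) := by
  unfold allVars
  induction List.range n with
  | nil => exact h
  | cons i l ih => exact .gen _ ih

end Truth

end OmegaCon

theorem mainTheorem2
    (S T : Set (OmegaCon.Fml OmegaCon.arith)) (α : OmegaCon.Fml OmegaCon.arith)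
    (hS : OmegaCon.Consistent S) (hT : OmegaCon.Consistent T)
    (hEA : OmegaCon.Includes S OmegaCon.EA) (hST : OmegaCon.Includes T S)
    (hα : OmegaCon.Numerates α T S) (Q : List OmegaCon.Quant) :
    OmegaCon.Provable (OmegaCon.TrTheory S α) ((OmegaCon.omegaCon α Q).lift OmegaCon.incl) := by
  open OmegaCon in
  refine .gen 1 (provable_lift_allVars _ ?_)
  have h₁ : 0 ∉ (va 1).varFinset := by simp
  have h₂ : 0 ∉ (quantsD (Q.map Quant.dual) 0 (negD (va 1))).varFinset := fun h =>
    (mem_varFinset_quantsD h).elim (by simp) fun ⟨j, hj⟩ => by simp at hj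
  have hneg := entails_tr_quantsD (α := α) hEA Q.length Q 0 (by omega) h₁
    fun j _ => by simp
  have hpos := provable_quants_provD_imp (S := S) (α := α) Q 0
    (zero_notMem_varFinset_numSub Q.length 0 h₁)
  have hdual := provable_provD_imp_tr (S := S) (α := α) h₂
  refine Entails.intro (Δ := []) (Entails.intro ?_)
  refine Entails.neg_intro ?_ (.mp (.weaken _ (.weaken _ hneg.intro))
    (.mp (.of_provable hdual _) (.hyp _ _)))
  exact .mp (.of_provable hpos _) (.weaken _ (.hyp _ _))
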